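/- Let $K$ be an abstract elementary class (AEC) in a finitary language $L$; no amalgamation, joint embedding or tameness is assumed. For an ordinal $\gamma$ let $\mathrm{gS}^{\gamma}(\emptyset)$ be the set of Galois types over $\emptyset$ of sequences of length $\gamma$ in models of $K$, i.e. classes of pairs $(a,M)$ with $M\in K$, $a\in{}^{\gamma}|M|$, under the equivalence relation generated by: $(a,M)$ and $(b,N)$ are related if some $K$-embeddings $f:M\to P$, $g:N\to P$ into a common $P\in K$ satisfy $f(a)=g(b)$; write $\mathrm{gtp}(a/\emptyset,M)$ for the class of $(a,M)$. Let $\kappa$ be an infinite cardinal. The $(<\kappa)$-Galois Morleyization $\hat K$ of $K$ consists of the expansions $\hat M$ of the models $M\in K$ to the language $\hat L\supseteq L$ which has in addition a relation symbol $R_p$ of arity $\gamma$ for each $\gamma<\kappa$ and $p\in\mathrm{gS}^{\gamma}(\emptyset)$, where $\hat M\models R_p[a]$ iff $\mathrm{gtp}(a/\emptyset,M)=p$. Let $1\le\beta<\kappa$ be an ordinal, $M\in K$, and $\mu$ an infinite cardinal. $\bullet$ $M$ has the *$\beta$-order property\* of length $\mu$* if there are a linear order $I$ with $|I|=\mu$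 and sequences $a_i\in{}^{\beta}|M|$ $(i\in I)$ such that $\mathrm{gtp}(a_{i_0}a_{i_1}/\emptyset,M)\ne\mathrm{gtp}(a_{j_1}a_{j_0}/\emptyset,M)$ whenever $i_0<i_1$ and $j_0<j_1$ in $I$. $\bullet$ $\hat M$ has the *syntactic $\beta$-order property\* of length $\mu$* if there are a linear order $I$ with $|I|=\mu$, sequences $a_i\in{}^{\beta}|M|$ $(i\in I)$ and a quantifier-free $\hat L_{\kappa,\kappa}$-formula $\varphi(x,y)$ such that for all $i,j\in I$: $i<j$ iff $\hat M\models\varphi[a_i,a_j]$. $\bullet$ The versions without "\*" are defined in the same way with $I=\mu$, the well-ordered set of ordinals below $\mu$. $\bullet$ $K$ (respectively $\hat K$) has one of these properties, with no length mentioned, if for every infinite cardinal $\mu$ some $M\in K$ (respectively $\hat M\in\hat K$) has it of length $\mu$. Put $\chi=|\mathrm{gS}^{\beta+\beta}(\emptyset)|$. Then: (2) For every $M\in K$ and all infinite cardinals $\lambda,\mu$: (a) if $\hat M$ has the syntactic $\beta$-order property\* of length $\mu$, then $M$ has the $\beta$-order property\* of length $\mu$; (b) if $\mu\ge(2^{\lambda+\chi})^+$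 and $M$ has the $\beta$-order property\* of length $\mu$, then $\hat M$ has the syntactic $\beta$-order property\* of length $\lambda^+$. (3) The following are equivalent: (a) $K$ has the $\beta$-order property; (b) $K$ has the $\beta$-order property\*; (c) $\hat K$ has the syntactic $\beta$-order property; (d) $\hat K$ has the syntactic $\beta$-order property\*. -/

import Mathlib

open Cardinal FirstOrder

universe u v w

/-- An abstract elementary class in a finitary language `L`: a class `mem` of `L`-structures together
with a relation `strong`, where `strong N S` says that the substructure `S` of `N` satisfies
`S ≤_K N`. -/
structure AEC (L : FirstOrder.Language.{u, u}) where
  mem : ∀ (M : Type u) [L.Structure M], Prop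
  strong : ∀ (N : Type u) [L.Structure N], L.Substructure N → Prop
  /-- Both members of an instance of `≤_K` belong to the class. -/
  mem_of_strong : ∀ (N : Type u) [L.Structure N] (S : L.Substructure N),
    strong N S → mem N ∧ mem S
  /-- The class and the relation are closed under isomorphism. -/
  mem_iso : ∀ (M N : Type u) [L.Structure M] [L.Structure N], (M ≃[L] N) → mem M → mem N
  strong_iso : ∀ (M N : Type u) [L.Structure M] [L.Structure N] (e : M ≃[L] N)
    (S : L.Substructure M), strong M S → strong N (S.map e.toHom)
  /-- `≤_K` is a partial order on the class (antisymmetry is automatic). -/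
  strong_refl : ∀ (N : Type u) [L.Structure N], mem N → strong N ⊤
  strong_trans : ∀ (N : Type u) [L.Structure N] (T : L.Substructure N) (S : L.Substructure T),
    strong N T → strong T S → strong N (S.map T.subtype.toHom)
  /-- Coherence: if `S ≤_K N`, `T ≤_K N` and `S ⊆ T`, then `S ≤_K T`. -/
  coherence : ∀ (N : Type u) [L.Structure N] (S T : L.Substructure N),
    strong N S → strong N T → S ≤ T → strong T (S.comap T.subtype.toHom)
  /-- The union of a nonempty well-ordered `≤_K`-increasing chain of members of the class is a
  member of the class and extends every structure of the chain. -/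
  chain_union : ∀ (ι : Type u) [LinearOrder ι] [WellFoundedLT ι] [Nonempty ι]
    (N : Type u) [L.Structure N] (S : ι → L.Substructure N),
    (∀ i, mem (S i)) →
    (∀ i j, i ≤ j → S i ≤ S j ∧ strong (S j) ((S i).comap (S j).subtype.toHom)) →
    (∀ x : N, ∃ i, x ∈ S i) →
    mem N ∧ ∀ i, strong N (S i)
  /-- Smoothness: if every structure of such a chain is `≤_K N`, then so is the union. -/
  chain_smooth : ∀ (ι : Type u) [LinearOrder ι] [WellFoundedLT ι] [Nonempty ι]
    (N : Type u) [L.Structure N] (S : ι → L.Substructure N),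
    Monotone S → (∀ i, strong N (S i)) → strong N (⨆ i, S i)
  /-- The Löwenheim-Skolem-Tarski axiom: a Löwenheim-Skolem number exists. -/
  lowenheim_skolem : ∃ θ : Cardinal.{u}, ℵ₀ ≤ θ ∧ L.card ≤ θ ∧
    ∀ (M : Type u) [L.Structure M], mem M → ∀ A : Set M,
      ∃ S : L.Substructure M, strong M S ∧ A ⊆ (S : Set M) ∧ #S ≤ #A + θ

namespace AEC

variable {L : FirstOrder.Language.{u, u}}

/-- A model of `K`, i.e. a member of the class. -/
structure Model (K : AEC L) where
  carrier : Type u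
  [str : L.Structure carrier]
  is_mem : K.mem carrier

attribute [instance] Model.str

/-- A sequence of length `γ` of elements of `X`, indexed by the ordinals below `γ`. -/
abbrev Seq (γ : Ordinal.{u}) (X : Type v) : Type (max (u + 1) v) := Set.Iio γ → X

/-- The concatenation of a sequence of length `β` and a sequence of length `γ`. -/
noncomputable def concat {β γ : Ordinal.{u}} {X : Type v} (a : Seq β X) (b : Seq γ X) :
    Seq (β + γ) X :=
  fun k => if h : k.1 < β then a ⟨k.1, h⟩ else
    b ⟨k.1 - β, (Ordinal.sub_lt_of_le (not_lt.mp h)).2 k.2⟩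

/-- `f` is a `K`-embedding: an isomorphism onto a `≤_K`-substructure. -/
def IsKEmbedding (K : AEC L) {M N : K.Model} (f : M.carrier ↪[L] N.carrier) : Prop :=
  K.strong N.carrier f.toHom.range

/-- A sequence of length `γ` in some model of `K`. -/
structure PointedModel (K : AEC L) (γ : Ordinal.{u}) where
  model : K.Model
  seq : Seq γ model.carrier

/-- Atomic equivalence (over the empty set): the two sequences are identified by `K`-embeddings of
the two models into a common model of `K`. -/
def AtomicEquiv (K : AEC L) (γ : Ordinal.{u}) (x y : K.PointedModel γ) : Prop :=
  ∃ (N : K.Model) (f : x.model.carrier ↪[L] N.carrier) (g : y.model.carrier ↪[L] N.carrier),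
    K.IsKEmbedding f ∧ K.IsKEmbedding g ∧ ∀ k, f (x.seq k) = g (y.seq k)

/-- The set of Galois types of sequences of length `γ` over the empty set: the quotient by the
equivalence relation generated by atomic equivalence (amalgamation is not assumed). -/
def GaloisType (K : AEC L) (γ : Ordinal.{u}) : Type (u + 1) := Quot (K.AtomicEquiv γ)

/-- The Galois type of the sequence `a` over the empty set, computed in the model `M`. -/
def gtp {K : AEC L} (M : K.Model) {γ : Ordinal.{u}} (a : Seq γ M.carrier) : K.GaloisType γ :=
  Quot.mk _ ⟨M, a⟩

end AEC

/-- A set of relation symbols whose arities are ordinals less than `κ`. -/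
structure InfRelations (κ : Cardinal.{u}) where
  Symb : Type v
  arity : Symb → Ordinal.{u}
  arity_lt : ∀ R, arity R < κ.ord

namespace InfRelations

variable {κ : Cardinal.{u}}

/-- An interpretation on `X` of the relation symbols in `P`. -/
def Interpretation (P : InfRelations.{u, v} κ) (X : Type u) : Type (max (u + 1) v) :=
  ∀ R : P.Symb, AEC.Seq (P.arity R) X → Prop

end InfRelations

/-- Quantifier-free formulas of the logic `(L ∪ P)_{κ,κ}` with variables from `V`, where `L` is a
finitary language and `P` a set of additional `(<κ)`-ary relation symbols: the closure of the atomic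
formulas under negation and conjunctions of fewer than `κ` formulas. -/
inductive QFFormula (L : FirstOrder.Language.{u, u}) {κ : Cardinal.{u}} (P : InfRelations.{u, v} κ)
    (V : Type w) : Type (max (u + 1) v w)
  | equal (s t : L.Term V) : QFFormula L P V
  | rel {n : ℕ} (R : L.Relations n) (ts : Fin n → L.Term V) : QFFormula L P V
  | infRel (R : P.Symb) (ts : AEC.Seq (P.arity R) (L.Term V)) : QFFormula L P V
  | neg (φ : QFFormula L P V) : QFFormula L P V
  | conj (ι : Type u) (hι : #ι < κ) (φ : ι → QFFormula L P V) : QFFormula L P V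

/-- Satisfaction of a quantifier-free formula in the `L ∪ P`-structure on `X` given by its
`L`-structure and the interpretation `I` of `P`. -/
def QFFormula.Realize {L : FirstOrder.Language.{u, u}} {κ : Cardinal.{u}} {P : InfRelations.{u, v} κ}
    {V : Type w} {X : Type u} [L.Structure X] (I : P.Interpretation X) :
    QFFormula L P V → (V → X) → Prop
  | .equal s t, e => s.realize e = t.realize e
  | .rel R ts, e => FirstOrder.Language.Structure.RelMap R (fun k => (ts k).realize e)
  | .infRel R ts, e => I R (fun k => (ts k).realize e)
  | .neg φ, e => ¬ φ.Realize I e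
  | .conj _ _ φ, e => ∀ k, (φ k).Realize I e

namespace AEC

variable {L : FirstOrder.Language.{u, u}}

/-- The relation symbols that the `(<κ)`-Galois Morleyization of `K` adds to `L`: a symbol `R_p` of
arity `l(p)` for each Galois type `p` over the empty set of length less than `κ`. -/
def morleyRelations (K : AEC L) (κ : Cardinal.{u}) : InfRelations.{u, u + 1} κ where
  Symb := Σ γ : Set.Iio κ.ord, K.GaloisType γ.1
  arity := fun R => R.1.1
  arity_lt := fun R => R.1.2

/-- The interpretation of the new symbols in the expansion `M̂` of a model `M` of `K`:
`R_p` holds of `a` if and only if `a` realizes `p`. -/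
def morleyInterpretation {K : AEC L} (κ : Cardinal.{u}) (M : K.Model) :
    (K.morleyRelations κ).Interpretation M.carrier :=
  fun R a => gtp M a = R.2

/-- Quantifier-free `L̂_{κ,κ}`-formulas `φ(x, y)` with `l(x) = l(y) = β`, where `L̂` is the language
of the `(<κ)`-Galois Morleyization of `K`. -/
abbrev MorleyFormula (K : AEC L) (κ : Cardinal.{u}) (β : Ordinal.{u}) : Type (u + 1) :=
  QFFormula L (K.morleyRelations κ) (Set.Iio β ⊕ Set.Iio β)

/-- `M̂ ⊨ φ[a, b]`. -/
def MorleySat {K : AEC L} {κ : Cardinal.{u}} (M : K.Model) {β : Ordinal.{u}}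
    (φ : K.MorleyFormula κ β) (a b : Seq β M.carrier) : Prop :=
  φ.Realize (morleyInterpretation κ M) (Sum.elim a b)

/-- The family `a` of sequences of length `β`, indexed by the linear order `I`, witnesses the
(Galois) `β`-order property in `M`. -/
def IsOrderWitness {K : AEC L} (M : K.Model) (β : Ordinal.{u}) {I : Type v} [LinearOrder I]
    (a : I → Seq β M.carrier) : Prop :=
  ∀ i₀ i₁ j₀ j₁ : I, i₀ < i₁ → j₀ < j₁ →
    gtp M (concat (a i₀) (a i₁)) ≠ gtp M (concat (a j₁) (a j₀))

/-- The family `a` of sequences of length `β`, indexed by the linear order `I`, witnesses the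
syntactic `β`-order property in the expansion `M̂` of `M`. -/
def IsSyntacticOrderWitness {K : AEC L} (M : K.Model) (κ : Cardinal.{u}) (β : Ordinal.{u})
    {I : Type v} [LinearOrder I] (a : I → Seq β M.carrier) : Prop :=
  ∃ φ : K.MorleyFormula κ β, ∀ i j : I, i < j ↔ MorleySat M φ (a i) (a j)

/-- `M` has the `β`-order property of length `μ`. -/
def Model.OrderProp {K : AEC L} (M : K.Model) (β : Ordinal.{u}) (μ : Cardinal.{u}) : Prop :=
  ∃ a : Set.Iio μ.ord → Seq β M.carrier, IsOrderWitness M β a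

/-- `M` has the `β`-order property* of length `μ`. -/
def Model.OrderPropStar {K : AEC L} (M : K.Model) (β : Ordinal.{u}) (μ : Cardinal.{u}) : Prop :=
  ∃ (I : Type u) (_ : LinearOrder I) (a : I → Seq β M.carrier), #I = μ ∧ IsOrderWitness M β a

/-- `M̂` has the syntactic `β`-order property of length `μ`. -/
def Model.SyntacticOrderProp {K : AEC L} (M : K.Model) (κ : Cardinal.{u}) (β : Ordinal.{u})
    (μ : Cardinal.{u}) : Prop :=
  ∃ a : Set.Iio μ.ord → Seq β M.carrier, IsSyntacticOrderWitness M κ β a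

/-- `M̂` has the syntactic `β`-order property* of length `μ`. -/
def Model.SyntacticOrderPropStar {K : AEC L} (M : K.Model) (κ : Cardinal.{u}) (β : Ordinal.{u})
    (μ : Cardinal.{u}) : Prop :=
  ∃ (I : Type u) (_ : LinearOrder I) (a : I → Seq β M.carrier),
    #I = μ ∧ IsSyntacticOrderWitness M κ β a

/-- `K` has the `β`-order property: of every infinite length, in some model of `K`. -/
def OrderProp (K : AEC L) (β : Ordinal.{u}) : Prop :=
  ∀ μ : Cardinal.{u}, ℵ₀ ≤ μ → ∃ M : K.Model, M.OrderProp β μ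

/-- `K` has the `β`-order property*. -/
def OrderPropStar (K : AEC L) (β : Ordinal.{u}) : Prop :=
  ∀ μ : Cardinal.{u}, ℵ₀ ≤ μ → ∃ M : K.Model, M.OrderPropStar β μ

/-- The `(<κ)`-Galois Morleyization `K̂` of `K` has the syntactic `β`-order property. -/
def SyntacticOrderProp (K : AEC L) (κ : Cardinal.{u}) (β : Ordinal.{u}) : Prop :=
  ∀ μ : Cardinal.{u}, ℵ₀ ≤ μ → ∃ M : K.Model, M.SyntacticOrderProp κ β μ

/-- The `(<κ)`-Galois Morleyization `K̂` of `K` has the syntactic `β`-order property*. -/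
def SyntacticOrderPropStar (K : AEC L) (κ : Cardinal.{u}) (β : Ordinal.{u}) : Prop :=
  ∀ μ : Cardinal.{u}, ℵ₀ ≤ μ → ∃ M : K.Model, M.SyntacticOrderPropStar κ β μ

end AEC

/-! A `K`-embedding preserves Galois types, hence all quantifier-free formulas of the Morleyization,
so truth of `φ[a, b]` depends only on the type of the concatenation `ab`. If `φ` orders a family,
increasing and decreasing pairs thus have different types.

Conversely, colour pairs `i < j` by types of concatenations. With `ν = λ + χ`, Erdős–Rado, `(2^ν)⁺ →
(ν⁺)²_ν`, gives a set of size `ν⁺` on which all increasing pairs realize one type `p`. Decreasing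
pairs omit `p` by the order property, so `R_p(x, y) ∧ x ≠ y` defines the order.

For the well-ordered versions, a linear order of size above `2^μ` contains `μ` or its reverse, and
the Galois order property survives reversal. -/

section ErdosRado

/-! ### Erdős–Rado for pairs, and well-ordered subsets of linear orders -/

/-- The terms naming the elements of a partition-closed subset: a term is given by an index `t`, a
colouring of the indices below `t` and a family of terms for these indices. -/
abbrev PartitionTerm (T C : Type u) [LinearOrder T] : Type u :=
  WType (fun n : (Σ t : T, (Set.Iio t → C)) => Set.Iio n.1)

open Classical in
/-- The element named by a term: one that is new and has the prescribed colours with the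
elements named by the subterms, if there is one. -/
noncomputable def PartitionTerm.eval {T C I : Type u} [LinearOrder T] (f : I → I → C) (d : I) :
    PartitionTerm T C → I
  | ⟨n, s⟩ => if h : ∃ y, ∀ k, y ≠ eval f d (s k) ∧ f y (eval f d (s k)) = n.2 k then
      h.choose else d

/-- Each node has at most `2 ^ ν` labels and at most `ν` children, and `2 ^ ν` absorbs products and
`ν`-th powers. -/
theorem PartitionTerm.mk_le {ν : Cardinal.{u}} (hν : ℵ₀ ≤ ν) {C : Type u} (hC : #C ≤ ν) :
    #(PartitionTerm (Order.succ ν).ord.ToType C) ≤ 2 ^ ν := by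
  have hpow : ∀ c : Cardinal.{u}, c ≤ 2 ^ ν → ∀ t : (Order.succ ν).ord.ToType,
      c ^ #(Set.Iio t) ≤ 2 ^ ν := by
    intro c hc t
    have ht : #(Set.Iio t) ≤ ν := by
      simpa using Order.lt_succ_iff.1 ((Cardinal.mk_Iio_lt t (by simp)).trans_eq
        (Cardinal.mk_ord_toType _))
    calc c ^ #(Set.Iio t) ≤ (2 ^ ν) ^ #(Set.Iio t) := Cardinal.power_le_power_right hc
      _ ≤ (2 ^ ν) ^ ν :=
        Cardinal.power_le_power_left (Cardinal.power_ne_zero _ two_ne_zero) ht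
      _ = 2 ^ ν := by rw [← Cardinal.power_mul, Cardinal.mul_eq_self hν]
  have hinf : ℵ₀ ≤ (2 : Cardinal.{u}) ^ ν := hν.trans (Cardinal.cantor ν).le
  have hT : #(Order.succ ν).ord.ToType ≤ 2 ^ ν := by
    rw [Cardinal.mk_ord_toType]; exact Order.succ_le_of_lt (Cardinal.cantor ν)
  refine WType.cardinalMk_le_of_le ?_
  calc _ ≤ Cardinal.sum fun _ : (Σ t : (Order.succ ν).ord.ToType, (Set.Iio t → C)) =>
          (2 : Cardinal.{u}) ^ ν := Cardinal.sum_le_sum _ _ fun n => hpow _ le_rfl n.1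
    _ = #(Σ t : (Order.succ ν).ord.ToType, (Set.Iio t → C)) * 2 ^ ν := Cardinal.sum_const' _ _
    _ ≤ 2 ^ ν * 2 ^ ν := by
      gcongr
      rw [Cardinal.mk_sigma]
      calc _ ≤ Cardinal.sum fun _ : (Order.succ ν).ord.ToType => (2 : Cardinal.{u}) ^ ν :=
            Cardinal.sum_le_sum _ _ fun t => by
              simpa using hpow #C (hC.trans (Cardinal.cantor ν).le) t
        _ = #(Order.succ ν).ord.ToType * 2 ^ ν := Cardinal.sum_const' _ _
        _ ≤ 2 ^ ν * 2 ^ ν := by gcongr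
        _ = 2 ^ ν := Cardinal.mul_eq_self hinf
    _ = 2 ^ ν := Cardinal.mul_eq_self hinf

/-- The term whose value has the same colours with the earlier values as the point `x`. -/
noncomputable def PartitionTerm.branch {T C I : Type u} [LinearOrder T] [WellFoundedLT T]
    (f : I → I → C) (d x : I) (t : T) : PartitionTerm T C :=
  ⟨⟨t, fun k => f x (eval f d (branch f d x k.1))⟩, fun k => branch f d x k.1⟩
termination_by wellFounded_lt.wrap t
decreasing_by all_goals exact k.2

theorem PartitionTerm.branch_spec {T C I : Type u} [LinearOrder T] [WellFoundedLT T]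
    (f : I → I → C) (d x : I) (hx : ∀ w : PartitionTerm T C, eval f d w ≠ x) {s t : T}
    (hst : s < t) :
    eval f d (branch f d x t) ≠ eval f d (branch f d x s) ∧
      f (eval f d (branch f d x t)) (eval f d (branch f d x s)) =
        f x (eval f d (branch f d x s)) := by
  have h : ∃ y, ∀ k : Set.Iio t, y ≠ eval f d (branch f d x k.1) ∧
      f y (eval f d (branch f d x k.1)) = f x (eval f d (branch f d x k.1)) :=
    -- The unnamed point `x` is itself a candidate, so the default `d` is never taken along its
    -- branch.
    ⟨x, fun k => ⟨(hx _).symm, rfl⟩⟩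
  have e : eval f d (branch f d x t) = h.choose := by
    rw [branch, PartitionTerm.eval]
    exact dif_pos h
  rw [e]
  exact h.choose_spec ⟨s, hst⟩

/-- The Erdős–Rado theorem for symmetric colourings of pairs. -/
theorem erdos_rado_pairs {ν : Cardinal.{u}} (hν : ℵ₀ ≤ ν) {I C : Type u} (hC : #C ≤ ν)
    (hI : 2 ^ ν < #I) (f : I → I → C) (hf : ∀ i j, f i j = f j i) :
    ∃ (H : Set I) (c : C), #H = Order.succ ν ∧ ∀ i ∈ H, ∀ j ∈ H, i ≠ j → f i j = c := by
  have hI0 : #I ≠ 0 := (bot_le.trans_lt hI).ne'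
  obtain ⟨d⟩ := Cardinal.mk_ne_zero_iff.1 hI0
  let T := (Order.succ ν).ord.ToType
  have hT : #T = Order.succ ν := Cardinal.mk_ord_toType _
  have hreg := Cardinal.isRegular_succ hν
  obtain ⟨x, hx⟩ : ∃ x, ∀ w : PartitionTerm T C, PartitionTerm.eval f d w ≠ x := by
    by_contra! h
    exact ((Cardinal.mk_le_of_surjective h).trans (PartitionTerm.mk_le hν hC)).not_gt hI
  -- The sequence `y` is end-homogeneous: the colour of a pair depends only on its earlier member. A
  -- pigeonhole on `f x (y t)` then makes it homogeneous.
  let y : T → I := fun t => PartitionTerm.eval f d (PartitionTerm.branch f d x t)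
  have hy : ∀ s t, s < t → y t ≠ y s ∧ f (y t) (y s) = f x (y s) := fun s t hst =>
    PartitionTerm.branch_spec f d x hx hst
  have hinj : Function.Injective y := by
    intro s t hst
    rcases lt_trichotomy s t with h | h | h
    · exact absurd hst.symm (hy s t h).1
    · exact h
    · exact absurd hst (hy t s h).1
  obtain ⟨c, hc⟩ := Cardinal.infinite_pigeonhole_card (fun t => f x (y t)) #T le_rfl
    (by rw [hT]; exact hreg.aleph0_le)
    (by rw [hT, hreg.cof_ord]; exact Order.lt_succ_of_le hC)
  refine ⟨y '' ((fun t => f x (y t)) ⁻¹' {c}), c, ?_, ?_⟩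
  · rw [Cardinal.mk_image_eq hinj]
    exact le_antisymm ((Cardinal.mk_set_le _).trans hT.le) (hT.ge.trans hc)
  · rintro _ ⟨s, hs, rfl⟩ _ ⟨t, ht, rfl⟩ hst
    rcases lt_trichotomy s t with h | h | h
    · rw [hf]; exact (hy s t h).2.trans hs
    · exact absurd (congrArg y h) hst
    · exact (hy t s h).2.trans ht

/-- The Erdős–Rado theorem for pairs in a linear order. -/
theorem erdos_rado_linearOrder {ν : Cardinal.{u}} (hν : ℵ₀ ≤ ν) {I C : Type u} [LinearOrder I]
    (hC : #C ≤ ν) (hI : 2 ^ ν < #I) (f : I → I → C) :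
    ∃ (H : Set I) (c : C), #H = Order.succ ν ∧ ∀ i ∈ H, ∀ j ∈ H, i < j → f i j = c := by
  obtain ⟨H, c, hH, h⟩ := erdos_rado_pairs hν hC hI (fun i j => f (min i j) (max i j))
    fun i j => by rw [min_comm, max_comm]
  refine ⟨H, c, hH, fun i hi j hj hij => ?_⟩
  simpa [hij.le] using h i hi j hj hij.ne

theorem exists_strictMono_toType {μ : Cardinal.{u}} {S : Type u} [LinearOrder S]
    [WellFoundedLT S] (h : μ ≤ #S) : ∃ s : μ.ord.ToType → S, StrictMono s := by
  have : Ordinal.type (α := μ.ord.ToType) (· < ·) ≤ Ordinal.type (α := S) (· < ·) := by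
    rw [Ordinal.type_toType]
    exact (Cardinal.ord_le_ord.2 h).trans (Cardinal.ord_le_type _)
  obtain ⟨s⟩ := Ordinal.type_le_iff'.1 this
  exact ⟨s, fun _ _ hab => s.map_rel_iff.2 hab⟩

/-- A linear order of cardinality greater than `2 ^ μ` contains a copy of the ordinal `μ` or of its
reverse. -/
theorem exists_strictMono_or_strictAnti {μ : Cardinal.{u}} (hμ : ℵ₀ ≤ μ) {I : Type u}
    [LinearOrder I] (hI : 2 ^ μ < #I) :
    ∃ h : μ.ord.ToType → I, StrictMono h ∨ StrictAnti h := by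
  obtain ⟨e⟩ : Nonempty (I ≃ (#I).ord.ToType) := Cardinal.eq.1 (by simp)
  -- Sierpiński's colouring: does the given order agree with a well-ordering on the pair?
  obtain ⟨H, c, hH, hc⟩ := erdos_rado_linearOrder hμ (C := ULift.{u} Prop)
    ((Cardinal.mk_le_aleph0).trans hμ) hI fun i j => ⟨e i < e j⟩
  obtain ⟨s, hs⟩ := exists_strictMono_toType (μ := μ) (S := e '' H) (by
    rw [Cardinal.mk_image_eq e.injective, hH]; exact Order.le_succ μ)
  have hmem : ∀ t, e.symm (s t) ∈ H := fun t => by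
    obtain ⟨i, hi, hit⟩ := (s t).2
    rw [← hit, e.symm_apply_apply]; exact hi
  have hlt : ∀ t t', t < t' → e (e.symm (s t)) < e (e.symm (s t')) := fun t t' h => by
    simpa using hs h
  have hne : ∀ t t', t < t' → e.symm (s t : (#I).ord.ToType) ≠ e.symm (s t') :=
    fun t t' h h' => (hlt t t' h).ne (congrArg e h')
  refine ⟨fun t => e.symm (s t), ?_⟩
  by_cases hc' : c.down
  · refine Or.inl fun t t' h => ?_
    rcases (hne t t' h).lt_or_gt with h' | h'
    · exact h'
    · exact absurd ((congrArg ULift.down (hc _ (hmem t') _ (hmem t) h')).mpr hc')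
        (hlt t t' h).not_gt
  · refine Or.inr fun t t' h => ?_
    rcases (hne t t' h).lt_or_gt with h' | h'
    · exact absurd ((congrArg ULift.down (hc _ (hmem t) _ (hmem t') h')).mp (hlt t t' h)) hc'
    · exact h'

end ErdosRado

/-! ### Galois types and quantifier-free formulas -/

namespace AEC

variable {L : FirstOrder.Language.{u, u}}

theorem isKEmbedding_refl (K : AEC L) (M : K.Model) :
    K.IsKEmbedding (Language.Embedding.refl L M.carrier : M.carrier ↪[L] M.carrier) := by
  have h : (Language.Embedding.refl L M.carrier).toHom.range = ⊤ := by
    ext x; simp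
  unfold IsKEmbedding
  rw [h]
  exact K.strong_refl _ M.is_mem

theorem IsKEmbedding.gtp_eq {K : AEC L} {M N : K.Model} {f : M.carrier ↪[L] N.carrier}
    (hf : K.IsKEmbedding f) {γ : Ordinal.{u}} (a : Seq γ M.carrier) :
    gtp M a = gtp N (fun k => f (a k)) :=
  Quot.sound ⟨N, f, Language.Embedding.refl L N.carrier, hf, K.isKEmbedding_refl N, fun _ => rfl⟩

theorem IsKEmbedding.realize_iff {K : AEC L} {κ : Cardinal.{u}} {M N : K.Model}
    {f : M.carrier ↪[L] N.carrier} (hf : K.IsKEmbedding f) {V : Type w} (e : V → M.carrier)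
    (φ : QFFormula L (K.morleyRelations κ) V) :
    φ.Realize (morleyInterpretation κ M) e ↔
      φ.Realize (morleyInterpretation κ N) (fun k => f (e k)) := by
  have ht : ∀ t : L.Term V, t.realize (fun k => f (e k)) = f (t.realize e) := fun t =>
    Language.HomClass.realize_term f
  induction φ with
  | equal s t => simp only [QFFormula.Realize, ht, f.injective.eq_iff]
  | rel R ts =>
    simp only [QFFormula.Realize, ht]
    exact (f.map_rel R _).symm
  | infRel R ts =>
    simp only [QFFormula.Realize, ht, morleyInterpretation]
    rw [hf.gtp_eq]
  | neg φ ih => exact not_congr ih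
  | conj ι hι φ ih => exact forall_congr' ih

/-- Quantifier-free formulas of the Morleyization are preserved by equality of Galois types. -/
theorem realize_iff_of_gtp_eq {K : AEC L} {κ : Cardinal.{u}} {M N : K.Model} {γ : Ordinal.{u}}
    {a : Seq γ M.carrier} {b : Seq γ N.carrier} (h : gtp M a = gtp N b) {V : Type w}
    (e : V → Set.Iio γ) (φ : QFFormula L (K.morleyRelations κ) V) :
    φ.Realize (morleyInterpretation κ M) (fun k => a (e k)) ↔
      φ.Realize (morleyInterpretation κ N) (fun k => b (e k)) := by
  -- One atomic step suffices, since both models embed in a common one; the quotient handles chains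
  -- of steps, so no amalgamation is needed.
  have key : ∀ x y : K.PointedModel γ, K.AtomicEquiv γ x y →
      φ.Realize (morleyInterpretation κ x.model) (fun k => x.seq (e k)) =
      φ.Realize (morleyInterpretation κ y.model) (fun k => y.seq (e k)) := by
    rintro x y ⟨N, f, g, hf, hg, hfg⟩
    rw [hf.realize_iff, hg.realize_iff]
    simp only [hfg]
  exact iff_of_eq (congrArg (Quot.lift (fun x : K.PointedModel γ =>
    φ.Realize (morleyInterpretation κ x.model) (fun k => x.seq (e k))) key) h)

/-- There are only set many Galois types of sequences of a given length. -/
theorem small_galoisType (K : AEC L) (γ : Ordinal.{u}) : Small.{u} (K.GaloisType γ) := by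
  obtain ⟨θ, -, -, hLS⟩ := K.lowenheim_skolem
  -- By Löwenheim–Skolem every type is realized in a model whose universe is a subset of this fixed
  -- set.
  let X : Type u := (#γ.ToType + θ).out
  let F : (Σ Y : Set X, {s : L.Structure Y // @K.mem Y s} × (γ.ToType → Y)) → K.GaloisType γ :=
    fun d => @gtp L K (@Model.mk L K d.1 d.2.1.1 d.2.1.2) γ fun k => d.2.2 (Ordinal.ToType.mk k)
  refine small_of_surjective (f := F) fun q => ?_
  induction q using Quot.ind with | _ x
  obtain ⟨M, a⟩ := x
  let a' : γ.ToType → M.carrier := fun t => a (Ordinal.ToType.mk.symm t)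
  obtain ⟨S, hS, hA, hcard⟩ := hLS M.carrier M.is_mem (Set.range a')
  obtain ⟨j⟩ : Nonempty (S ↪ X) := by
    rw [← Cardinal.le_def, Cardinal.mk_out]
    exact hcard.trans (by gcongr; exact Cardinal.mk_range_le)
  let e : S ≃ Set.range j := Equiv.ofInjective j j.injective
  let str : L.Structure (Set.range j) := e.inducedStructure
  let e' : S ≃[L] Set.range j := e.inducedStructureEquiv
  have hmem : K.mem (Set.range j) := K.mem_iso _ _ e' (K.mem_of_strong _ _ hS).2
  let N : K.Model := ⟨Set.range j, hmem⟩
  let f : N.carrier ↪[L] M.carrier := S.subtype.comp e'.symm.toEmbedding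
  have hf : K.IsKEmbedding f := by
    have : f.toHom.range = S := by
      ext x
      rw [Language.Hom.mem_range]
      constructor
      · rintro ⟨y, rfl⟩
        exact (e'.symm y).2
      · intro hx
        refine ⟨e' ⟨x, hx⟩, ?_⟩
        change ((e'.symm (e' ⟨x, hx⟩) : S) : M.carrier) = x
        rw [e'.symm_apply_apply]
    unfold IsKEmbedding
    rw [this]
    exact hS
  refine ⟨⟨Set.range j, ⟨str, hmem⟩, fun t => e' ⟨a' t, hA ⟨t, rfl⟩⟩⟩, ?_⟩
  refine (hf.gtp_eq _).trans ?_
  change gtp M _ = gtp M _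
  congr 1
  funext k
  change ((e'.symm (e' _) : S) : M.carrier) = a k
  rw [e'.symm_apply_apply]
  simp [a']

/-! ### Order witnesses and the formula defining the order -/

/-- The position in the concatenation of two sequences of length `β` of a position in one of the
two sequences. -/
def concatIndex (β : Ordinal.{u}) : Set.Iio β ⊕ Set.Iio β → Set.Iio (β + β)
  | .inl k => ⟨k.1, (Set.mem_Iio.1 k.2).trans_le le_self_add⟩
  | .inr k => ⟨β + k.1, add_lt_add_right (Set.mem_Iio.1 k.2) β⟩

theorem concat_concatIndex {β : Ordinal.{u}} {X : Type v} (a b : Seq β X) :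
    (fun k => concat a b (concatIndex β k)) = Sum.elim a b := by
  funext k
  rcases k with k | k
  · have : k.1 < β := k.2
    simp [concat, concatIndex, this]
  · simp [concat, concatIndex]

theorem comp_concat {β γ : Ordinal.{u}} {X : Type v} {Y : Type w} (F : X → Y) (a : Seq β X)
    (b : Seq γ X) (k : Set.Iio (β + γ)) :
    F (concat a b k) = concat (fun i => F (a i)) (fun i => F (b i)) k := by
  unfold concat
  split <;> rfl

theorem morleySat_iff_of_gtp_eq {K : AEC L} {κ : Cardinal.{u}} {M : K.Model} {β : Ordinal.{u}}
    {a b c d : Seq β M.carrier} (h : gtp M (concat a b) = gtp M (concat c d))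
    (φ : K.MorleyFormula κ β) : MorleySat M φ a b ↔ MorleySat M φ c d := by
  simpa only [MorleySat, concat_concatIndex] using realize_iff_of_gtp_eq h (concatIndex β) φ

theorem IsSyntacticOrderWitness.isOrderWitness {K : AEC L} {M : K.Model} {κ : Cardinal.{u}}
    {β : Ordinal.{u}} {I : Type v} [LinearOrder I] {a : I → Seq β M.carrier}
    (h : IsSyntacticOrderWitness M κ β a) : IsOrderWitness M β a := by
  obtain ⟨φ, hφ⟩ := h
  intro i₀ i₁ j₀ j₁ hi hj he
  exact hj.not_gt ((hφ _ _).2 ((morleySat_iff_of_gtp_eq he φ).1 ((hφ _ _).1 hi)))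

theorem IsSyntacticOrderWitness.comp {K : AEC L} {M : K.Model} {κ : Cardinal.{u}}
    {β : Ordinal.{u}} {I : Type v} {J : Type w} [LinearOrder I] [LinearOrder J]
    {a : I → Seq β M.carrier} (h : IsSyntacticOrderWitness M κ β a) {f : J → I}
    (hf : StrictMono f) : IsSyntacticOrderWitness M κ β (a ∘ f) := by
  obtain ⟨φ, hφ⟩ := h
  exact ⟨φ, fun i j => hf.lt_iff_lt.symm.trans (hφ _ _)⟩

theorem IsOrderWitness.comp_strictMono {K : AEC L} {M : K.Model}
    {β : Ordinal.{u}} {I : Type v} {J : Type w} [LinearOrder I] [LinearOrder J]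
    {a : I → Seq β M.carrier} (h : IsOrderWitness M β a) {f : J → I}
    (hf : StrictMono f) : IsOrderWitness M β (a ∘ f) :=
  fun _ _ _ _ hi hj => h _ _ _ _ (hf hi) (hf hj)

/-- Reversing the order only swaps the two sides of the required inequality of types. -/
theorem IsOrderWitness.comp_strictAnti {K : AEC L} {M : K.Model}
    {β : Ordinal.{u}} {I : Type v} {J : Type w} [LinearOrder I] [LinearOrder J]
    {a : I → Seq β M.carrier} (h : IsOrderWitness M β a) {f : J → I}
    (hf : StrictAnti f) : IsOrderWitness M β (a ∘ f) :=
  fun _ _ _ _ hi hj => (h _ _ _ _ (hf hj) (hf hi)).symm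

/-- The formula saying that the concatenation of two sequences realizes `p` and that the two
sequences are different. -/
noncomputable def orderFormula {K : AEC L} {κ : Cardinal.{u}} (hκ : ℵ₀ ≤ κ) {β : Ordinal.{u}}
    (hβκ : β < κ.ord) (p : K.GaloisType (β + β)) : K.MorleyFormula κ β :=
  .conj (ULift.{u} Bool) ((Cardinal.lt_aleph0_of_finite _).trans_le hκ) fun t =>
    match t.down with
    | true => .infRel (P := K.morleyRelations κ)
        -- An infinite cardinal is closed under ordinal addition, so `R_p` is a symbol of the
        -- Morleyization.
        ⟨⟨β + β, Ordinal.isPrincipal_add_ord hκ hβκ hβκ⟩, p⟩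
        (concat (fun k => .var (.inl k)) (fun k => .var (.inr k)))
    | false => .neg (.conj β.ToType (by rw [Cardinal.mk_toType]; exact Cardinal.lt_ord.1 hβκ)
        fun k => .equal (.var (.inl (Ordinal.ToType.mk.symm k)))
          (.var (.inr (Ordinal.ToType.mk.symm k))))

theorem morleySat_orderFormula {K : AEC L} {κ : Cardinal.{u}} (hκ : ℵ₀ ≤ κ) {β : Ordinal.{u}}
    (hβκ : β < κ.ord) (p : K.GaloisType (β + β)) (M : K.Model) (a b : Seq β M.carrier) :
    MorleySat M (orderFormula hκ hβκ p) a b ↔ gtp M (concat a b) = p ∧ a ≠ b := by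
  have h : ∀ k : Set.Iio (β + β),
      Language.Term.realize (Sum.elim a b) (concat (fun k => (.var (.inl k) : L.Term _))
        (fun k => .var (.inr k)) k) = concat a b k := fun k => comp_concat _ _ _ k
  have h₁ : (∀ k : β.ToType, a (Ordinal.ToType.mk.symm k) = b (Ordinal.ToType.mk.symm k)) ↔
      a = b := ⟨fun H => funext fun k => by simpa using H (Ordinal.ToType.mk k),
        fun H k => by rw [H]⟩
  simp only [MorleySat, orderFormula, QFFormula.Realize, ULift.forall, Bool.forall_bool,
    Language.Term.realize_var, Sum.elim_inl, Sum.elim_inr, h₁, morleyInterpretation]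
  rw [and_comm]
  refine and_congr ?_ Iff.rfl
  exact iff_of_eq (congrArg (fun s => gtp M s = p) (funext h))

theorem IsOrderWitness.injective {K : AEC L} {M : K.Model} {β : Ordinal.{u}} {I : Type v}
    [LinearOrder I] {a : I → Seq β M.carrier} (h : IsOrderWitness M β a) :
    Function.Injective a := by
  have key : ∀ i j, i < j → a i ≠ a j := fun i j hij e => h i j i j hij hij (by rw [e])
  intro i j hij
  rcases lt_trichotomy i j with h | h | h
  · exact absurd hij (key _ _ h)
  · exact h
  · exact absurd hij.symm (key _ _ h)

/-- A long witness to the Galois order property contains a witness to the syntactic order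
property. -/
theorem IsOrderWitness.exists_isSyntacticOrderWitness {K : AEC L} {M : K.Model}
    {κ : Cardinal.{u}} (hκ : ℵ₀ ≤ κ) {β : Ordinal.{u}} (hβκ : β < κ.ord) {ν : Cardinal.{u}}
    (hν : ℵ₀ ≤ ν) (hK : #(K.GaloisType (β + β)) ≤ Cardinal.lift.{u + 1} ν) {I : Type u}
    [LinearOrder I] (hI : 2 ^ ν < #I) {a : I → Seq β M.carrier} (h : IsOrderWitness M β a) :
    ∃ H : Set I, #H = Order.succ ν ∧ IsSyntacticOrderWitness M κ β (fun i : H => a i) := by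
  have := K.small_galoisType (β + β)
  let G := Shrink.{u} (K.GaloisType (β + β))
  have hG : #G ≤ ν := by
    rw [← Cardinal.lift_le.{u + 1}, Cardinal.lift_mk_shrink'']
    exact hK
  have hGG : #(G × G) ≤ ν := by
    rw [Cardinal.mk_prod, Cardinal.lift_id, ← Cardinal.mul_eq_self hν]
    gcongr
  -- Only the first coordinate of the colour is used below; the order property separates the
  -- decreasing pairs.
  obtain ⟨H, c, hH, hc⟩ := erdos_rado_linearOrder hν hGG hI fun i j =>
    (equivShrink _ (gtp M (concat (a i) (a j))), equivShrink _ (gtp M (concat (a j) (a i))))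
  have h₁ : ∀ i ∈ H, ∀ j ∈ H, i < j → gtp M (concat (a i) (a j)) = (equivShrink _).symm c.1 :=
    fun i hi j hj hij => by rw [← hc i hi j hj hij]; simp
  refine ⟨H, hH, orderFormula hκ hβκ ((equivShrink _).symm c.1), fun i j => ?_⟩
  rw [morleySat_orderFormula]
  refine ⟨fun hij => ⟨h₁ _ i.2 _ j.2 hij, fun e => hij.ne (Subtype.ext (h.injective e))⟩, ?_⟩
  rintro ⟨hp, hne⟩
  rcases lt_trichotomy i j with hij | rfl | hij
  · exact hij
  · exact absurd rfl hne
  · exact absurd ((h₁ _ j.2 _ i.2 hij).trans hp.symm) (h _ _ _ _ hij hij)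

theorem Model.orderProp_iff {K : AEC L} {M : K.Model} {β : Ordinal.{u}} {μ : Cardinal.{u}} :
    M.OrderProp β μ ↔ ∃ a : μ.ord.ToType → Seq β M.carrier, IsOrderWitness M β a :=
  ⟨fun ⟨_, h⟩ => ⟨_, h.comp_strictMono Ordinal.ToType.mk.symm.strictMono⟩,
    fun ⟨_, h⟩ => ⟨_, h.comp_strictMono Ordinal.ToType.mk.strictMono⟩⟩

end AEC

/-! ### The main theorem -/

theorem mainTheorem8 {L : FirstOrder.Language.{u, u}} (K : AEC L) (κ : Cardinal.{u}) (hκ : ℵ₀ ≤ κ)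
    (β : Ordinal.{u}) (hβ : 1 ≤ β) (hβκ : β < κ.ord) :
    (∀ (M : K.Model) (lam μ : Cardinal.{u}), ℵ₀ ≤ lam → ℵ₀ ≤ μ →
      (M.SyntacticOrderPropStar κ β μ → M.OrderPropStar β μ) ∧
      (Order.succ ((2 : Cardinal.{u + 1}) ^
          (Cardinal.lift.{u + 1, u} lam + #(K.GaloisType (β + β)))) ≤
            Cardinal.lift.{u + 1, u} μ →
        M.OrderPropStar β μ → M.SyntacticOrderPropStar κ β (Order.succ lam))) ∧
    List.TFAE [K.OrderProp β, K.OrderPropStar β, K.SyntacticOrderProp κ β,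
      K.SyntacticOrderPropStar κ β] := by
  have := K.small_galoisType (β + β)
  let χ : Cardinal.{u} := #(Shrink.{u} (K.GaloisType (β + β)))
  have hχ : Cardinal.lift.{u + 1} χ = #(K.GaloisType (β + β)) := Cardinal.lift_mk_shrink'' _
  have hstar : ∀ (M : K.Model) (μ : Cardinal.{u}), M.SyntacticOrderPropStar κ β μ →
      M.OrderPropStar β μ := fun M μ ⟨I, _, a, hI, ha⟩ => ⟨I, _, a, hI, ha.isOrderWitness⟩
  refine ⟨fun M lam μ hlam hμ => ⟨hstar M μ, ?_⟩, ?_⟩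
  · rintro hle ⟨I, _, a, rfl, ha⟩
    rw [← hχ, ← Cardinal.lift_add, ← Cardinal.lift_two.{u + 1, u}, ← Cardinal.lift_power,
      Order.succ_le_iff, Cardinal.lift_lt] at hle
    obtain ⟨H, hH, hw⟩ := ha.exists_isSyntacticOrderWitness hκ hβκ
      (hlam.trans (self_le_add_right lam χ))
      (by rw [← hχ, Cardinal.lift_le]; exact self_le_add_left _ _) hle
    -- The homogeneous set has size `(lam + χ)⁺`; a subset of size exactly `lam⁺` is kept.
    obtain ⟨J, hJ⟩ := Cardinal.le_mk_iff_exists_set.1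
      ((Order.succ_le_succ (self_le_add_right lam χ)).trans hH.ge)
    exact ⟨J, inferInstance, _, hJ, hw.comp (Subtype.strictMono_coe _)⟩
  tfae_have 1 → 2 := fun h μ hμ => by
    obtain ⟨M, hM⟩ := h μ hμ
    obtain ⟨a, ha⟩ := AEC.Model.orderProp_iff.1 hM
    exact ⟨M, _, _, a, Cardinal.mk_ord_toType _, ha⟩
  tfae_have 2 → 1 := fun h μ hμ => by
    obtain ⟨M, I, _, a, hI, ha⟩ := h (Order.succ (2 ^ μ))
      ((hμ.trans (Cardinal.cantor μ).le).trans (Order.le_succ _))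
    obtain ⟨f, hf | hf⟩ := exists_strictMono_or_strictAnti hμ
      ((Order.lt_succ _).trans_eq hI.symm)
    · exact ⟨M, AEC.Model.orderProp_iff.2 ⟨_, ha.comp_strictMono hf⟩⟩
    · exact ⟨M, AEC.Model.orderProp_iff.2 ⟨_, ha.comp_strictAnti hf⟩⟩
  tfae_have 1 → 3 := fun h μ hμ => by
    have hν : ℵ₀ ≤ μ + χ := hμ.trans (self_le_add_right _ _)
    obtain ⟨M, hM⟩ := h (Order.succ (2 ^ (μ + χ)))
      ((hν.trans (Cardinal.cantor _).le).trans (Order.le_succ _))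
    obtain ⟨a, ha⟩ := AEC.Model.orderProp_iff.1 hM
    obtain ⟨H, hH, hw⟩ := ha.exists_isSyntacticOrderWitness hκ hβκ hν
      (by rw [← hχ, Cardinal.lift_le]; exact self_le_add_left _ _)
      (by rw [Cardinal.mk_ord_toType]; exact Order.lt_succ _)
    -- Here the index order is an ordinal, so `H` is well-ordered and contains a copy of `μ`.
    obtain ⟨s, hs⟩ := exists_strictMono_toType (μ := μ) (S := H)
      (by rw [hH]; exact (self_le_add_right _ _).trans (Order.le_succ _))
    exact ⟨M, _, hw.comp (hs.comp Ordinal.ToType.mk.strictMono)⟩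
  tfae_have 3 → 4 := fun h μ hμ => by
    obtain ⟨M, a, ha⟩ := h μ hμ
    exact ⟨M, _, _, _, Cardinal.mk_ord_toType μ, ha.comp Ordinal.ToType.mk.symm.strictMono⟩
  tfae_have 4 → 2 := fun h μ hμ => by
    obtain ⟨M, hM⟩ := h μ hμ
    exact ⟨M, hstar M μ hM⟩
  tfae_finish
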